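/- Fix a damping factor $\alpha\in[0,1)$. For each $n\ge 1$ let $\{1,\dots,n\}=C_1\sqcup C_2$ be a partition of the vertices into two communities and let $p=p_n,\ q=q_n\in[0,1]$. Let $G_n$ be the random undirected graph of the stochastic block model: unordered pairs of vertices are edges independently of each other, a pair within one community with probability $p$ and a pair across the communities with probability $q$ (self-loops may either be included as pairs within a community or be forbidden; the result is asserted for both conventions). Let $A=(A_{ij})$ be the adjacency matrix, $d=A\mathbf 1$ the degree vector, $D=\mathrm{diag}(d)$ and $P=AD^{-1}$. Let $w_{\max}$ and $w_{\min}$ be the maximum and minimum over $i$ of the expected degrees $\mathbb E(d_i)$. Assume that $\log^3 n=o(w_{\min})$, that $w_{\max}/w_{\min}\le K$ for all large $n$ with a constant $K$ independent of $n$, and that $v=v^{(n)}$ are deterministic probability vectors on $\{1,\dots,n\}$ with $\|v\|_2=O(1/\sqrt n)$. Let $$\pi=(1-\alpha)(I-\alpha P)^{-1}v$$ be the personalized PageRank with preference vector $v$, i.e. the stationary distribution of the chain with column-stochastic transition matrix $\alpha P+(1-\alpha)v\mathbf 1^T$ (when $G_n$ has no vertex of degree $0$), and let $$\overline\pi_{\rm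 SBM}=(1-\alpha)\left(I-\alpha\overline P\right)^{-1}v,\qquad \overline P=\mathbb E(A)\,\mathbb E(D)^{-1}.$$ Then $\|\pi-\overline\pi_{\rm SBM}\|_{TV}=o(1)$ with high probability; that is, there are a deterministic sequence $\psi(n)\to0$ and constants $c>0$, $K'$, $N$ such that for all $n>N$, with probability at least $1-K'n^{-c}$, all degrees of $G_n$ are positive and $$\frac12\sum_{i=1}^n\left|\pi_i-(\overline\pi_{\rm SBM})_i\right|\le\psi(n).$$ -/

import Mathlib

open MeasureTheory ProbabilityTheory Filter Topology Asymptotics Matrix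

noncomputable section

namespace PageRankSBM

/-! ### Linear algebra: random walks, PageRank, total variation -/

/-- The degree vector `d = A 1` of a (possibly weighted) adjacency matrix. -/
def degree {n : ℕ} (A : Matrix (Fin n) (Fin n) ℝ) : Fin n → ℝ :=
  fun i => ∑ j, A i j

/-- The column-stochastic transition matrix `P = A D⁻¹` of the simple random walk,
with `D = diag (A 1)`. -/
def transition {n : ℕ} (A : Matrix (Fin n) (Fin n) ℝ) : Matrix (Fin n) (Fin n) ℝ :=
  A * Matrix.diagonal (fun j => (degree A j)⁻¹)

/-- Personalized PageRank `(1 - α) (I - α P)⁻¹ v`. The theorem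
`isPageRank_iff` below shows that, for a stochastic `P`, it is the unique stationary
distribution of the chain with transition matrix `α P + (1 - α) v 1ᵀ`. -/
def pageRank {n : ℕ} (α : ℝ) (P : Matrix (Fin n) (Fin n) ℝ) (v : Fin n → ℝ) : Fin n → ℝ :=
  (1 - α) • ((1 - α • P)⁻¹ *ᵥ v)

/-- Being a probability vector. -/
def IsProbVec {n : ℕ} (x : Fin n → ℝ) : Prop :=
  (∀ i, 0 ≤ x i) ∧ ∑ i, x i = 1

/-- Total variation distance `½ ‖x - y‖₁`. -/
def tvDist {n : ℕ} (x y : Fin n → ℝ) : ℝ :=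
  (1 / 2) * ∑ i, |x i - y i|

/-- The Euclidean norm `√(∑ᵢ xᵢ²)`. -/
def norm2 {n : ℕ} (x : Fin n → ℝ) : ℝ :=
  Real.sqrt (∑ i, x i ^ 2)

/-! ### The stochastic block model with two communities -/

/-- The probability that the pair `{i, j}` is an edge, where `C` is the first community and its
complement the second one: `p` inside a community, `q` across. The flag `loops` says whether
pairs `{i, i}` count as pairs inside a community (so that self-loops are allowed) or are
never edges. -/
def edgeProb {n : ℕ} (loops : Bool) (C : Finset (Fin n)) (p q : unitInterval) :
    Sym2 (Fin n) → unitInterval :=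
  Sym2.lift ⟨fun i j =>
    if i = j ∧ loops = false then 0 else if (i ∈ C ↔ j ∈ C) then p else q, by
      intro i j
      simp only [eq_comm (a := i) (b := j), iff_comm (a := i ∈ C) (b := j ∈ C)]⟩

/-- A sample: which unordered pairs of vertices are edges. -/
abbrev Sample (n : ℕ) : Type := Sym2 (Fin n) → Bool

/-- The law of the stochastic block model: all unordered pairs are independent, each of them is
an edge with its probability `edgeProb`. -/
def sbm {n : ℕ} (loops : Bool) (C : Finset (Fin n)) (p q : unitInterval) : Measure (Sample n) :=
  Measure.pi (fun e => bernoulliMeasure true false (edgeProb loops C p q e))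

/-- The adjacency matrix of a sample. -/
def adj {n : ℕ} (ω : Sample n) : Matrix (Fin n) (Fin n) ℝ :=
  Matrix.of fun i j => if ω s(i, j) = true then 1 else 0

/-- The expected adjacency matrix `𝔼 A`. -/
def meanAdj {n : ℕ} (loops : Bool) (C : Finset (Fin n)) (p q : unitInterval) :
    Matrix (Fin n) (Fin n) ℝ :=
  Matrix.of fun i j => ∫ ω, adj ω i j ∂(sbm loops C p q)

/-- The expected degrees `𝔼 dᵢ`. -/
def meanDegree {n : ℕ} (loops : Bool) (C : Finset (Fin n)) (p q : unitInterval) : Fin n → ℝ :=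
  fun i => ∫ ω, degree (adj ω) i ∂(sbm loops C p q)

/-- The average transition matrix `𝔼(A) 𝔼(D)⁻¹`. -/
def meanTransition {n : ℕ} (loops : Bool) (C : Finset (Fin n)) (p q : unitInterval) :
    Matrix (Fin n) (Fin n) ℝ :=
  meanAdj loops C p q * Matrix.diagonal (fun j => (meanDegree loops C p q j)⁻¹)

/-- The maximum expected degree. -/
def wMax {n : ℕ} (loops : Bool) (C : Finset (Fin n)) (p q : unitInterval) : ℝ :=
  ⨆ i, meanDegree loops C p q i

/-- The minimum expected degree. -/
def wMin {n : ℕ} (loops : Bool) (C : Finset (Fin n)) (p q : unitInterval) : ℝ :=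
  ⨅ i, meanDegree loops C p q i

/-- The events `E n` hold with high probability: for some `c > 0`, the probability of `E n` is
`1 - O(n ^ (-c))`. -/
def WHP {Ω : ℕ → Type} [∀ n, MeasurableSpace (Ω n)] (μ : ∀ n, Measure (Ω n))
    (E : ∀ n, Set (Ω n)) : Prop :=
  ∃ c : ℝ, 0 < c ∧ ∃ K : ℝ, ∃ N : ℕ, ∀ n : ℕ, N < n →
    1 - K * (n : ℝ) ^ (-c) ≤ (μ n).real (E n)

/-! ### PageRank is the stationary distribution of the modified chain -/

theorem eq_zero_of_subinvariant {n : ℕ} {α : ℝ} (h1 : α < 1)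
    {P : Matrix (Fin n) (Fin n) ℝ} (hs : ∀ j, ∑ i, P i j = 1)
    {y : Fin n → ℝ} (hy : ∀ i, 0 ≤ y i) (h : ∀ i, y i ≤ α * ∑ j, P i j * y j) : y = 0 := by
  have h2 : ∑ i, y i ≤ α * ∑ i, y i := by
    calc ∑ i, y i ≤ ∑ i, α * ∑ j, P i j * y j := Finset.sum_le_sum fun i _ => h i
      _ = α * ∑ j, (∑ i, P i j) * y j := by
          rw [← Finset.mul_sum, Finset.sum_comm]; simp only [Finset.sum_mul]
      _ = α * ∑ i, y i := by simp [hs]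
  have h3 : 0 ≤ ∑ i, y i := Finset.sum_nonneg fun i _ => hy i
  have h4 : ∑ i, y i = 0 := by nlinarith
  funext i
  exact (Finset.sum_eq_zero_iff_of_nonneg fun i _ => hy i).1 h4 i (Finset.mem_univ i)

theorem isUnit_det_one_sub {n : ℕ} {α : ℝ} (h0 : 0 ≤ α) (h1 : α < 1)
    {P : Matrix (Fin n) (Fin n) ℝ} (hP : ∀ i j, 0 ≤ P i j) (hs : ∀ j, ∑ i, P i j = 1) :
    IsUnit (1 - α • P).det := by
  rw [isUnit_iff_ne_zero]
  intro hdet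
  obtain ⟨x, hx, hx0⟩ := Matrix.exists_mulVec_eq_zero_iff.2 hdet
  apply hx
  have hx1 : ∀ i, x i = α * ∑ j, P i j * x j := by
    intro i
    have := congrFun hx0 i
    simp only [Matrix.sub_mulVec, Matrix.one_mulVec, Matrix.smul_mulVec, Pi.sub_apply,
      Pi.smul_apply, Pi.zero_apply, smul_eq_mul] at this
    simp only [Matrix.mulVec, dotProduct] at this
    linarith
  have := eq_zero_of_subinvariant h1 hs (y := fun i => |x i|) (fun i => abs_nonneg _) (by
    intro i
    calc |x i| = |α * ∑ j, P i j * x j| := by rw [← hx1 i]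
      _ = α * |∑ j, P i j * x j| := by rw [abs_mul, abs_of_nonneg h0]
      _ ≤ α * ∑ j, |P i j * x j| :=
          mul_le_mul_of_nonneg_left (Finset.abs_sum_le_sum_abs _ _) h0
      _ = α * ∑ j, P i j * |x j| := by simp only [abs_mul, abs_of_nonneg (hP _ _)])
  funext i
  exact abs_eq_zero.1 (congrFun this i)

/-- For a column-stochastic matrix `P`, `pageRank α P v` is the unique stationary distribution
of the chain with transition matrix `α P + (1 - α) v 1ᵀ`. -/
theorem isPageRank_iff {n : ℕ} {α : ℝ} (h0 : 0 ≤ α) (h1 : α < 1)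
    {P : Matrix (Fin n) (Fin n) ℝ} (hP : ∀ i j, 0 ≤ P i j) (hs : ∀ j, ∑ i, P i j = 1)
    {v : Fin n → ℝ} (hv : IsProbVec v) (π : Fin n → ℝ) :
    (IsProbVec π ∧ (α • P + (1 - α) • Matrix.vecMulVec v 1) *ᵥ π = π) ↔
      π = pageRank α P v := by
  have hu := isUnit_det_one_sub h0 h1 hP hs
  have key : ∀ x : Fin n → ℝ, x = pageRank α P v ↔ ∀ i, x i = α * ∑ j, P i j * x j + (1 - α) * v i := by
    intro x
    have e1 : x = pageRank α P v ↔ (1 - α • P) *ᵥ x = (1 - α) • v := by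
      unfold pageRank
      constructor
      · rintro rfl
        rw [Matrix.mulVec_smul, Matrix.mulVec_mulVec, Matrix.mul_nonsing_inv _ hu,
          Matrix.one_mulVec]
      · intro h
        rw [← Matrix.mulVec_smul, ← h, Matrix.mulVec_mulVec, Matrix.nonsing_inv_mul _ hu,
          Matrix.one_mulVec]
    rw [e1, funext_iff]
    refine forall_congr' fun i => ?_
    simp only [Matrix.sub_mulVec, Matrix.one_mulVec, Matrix.smul_mulVec, Pi.sub_apply,
      Pi.smul_apply, smul_eq_mul]
    simp only [Matrix.mulVec, dotProduct]
    constructor <;> intro h <;> linarith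
  have stat : ∀ x : Fin n → ℝ, ∑ i, x i = 1 →
      ((α • P + (1 - α) • Matrix.vecMulVec v 1) *ᵥ x = x ↔
        ∀ i, x i = α * ∑ j, P i j * x j + (1 - α) * v i) := by
    intro x hx
    rw [funext_iff]
    refine forall_congr' fun i => ?_
    have e2 : ∑ j, v i * x j = v i := by rw [← Finset.mul_sum, hx, mul_one]
    simp only [Matrix.add_mulVec, Matrix.smul_mulVec, Pi.add_apply, Pi.smul_apply, smul_eq_mul]
    simp only [Matrix.mulVec, dotProduct, Matrix.vecMulVec_apply, Pi.one_apply, mul_one, e2]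
    exact eq_comm
  constructor
  · rintro ⟨hp, h⟩
    exact (key π).2 ((stat π hp.2).1 h)
  · intro h
    have h2 := (key π).1 h
    have hsum : ∑ i, π i = 1 := by
      have : ∑ i, π i = α * ∑ i, π i + (1 - α) := by
        calc ∑ i, π i = ∑ i, (α * ∑ j, P i j * π j + (1 - α) * v i) :=
              Finset.sum_congr rfl fun i _ => h2 i
          _ = α * ∑ j, (∑ i, P i j) * π j + (1 - α) * ∑ i, v i := by
              rw [Finset.sum_add_distrib, ← Finset.mul_sum, ← Finset.mul_sum, Finset.sum_comm]
              simp only [Finset.sum_mul]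
          _ = _ := by simp [hs, hv.2]
      have h3 : (1 - α) * (∑ i, π i - 1) = 0 := by linarith
      rcases mul_eq_zero.1 h3 with h4 | h4 <;> linarith
    have hneg := eq_zero_of_subinvariant h1 hs (y := fun i => max (-π i) 0)
      (fun i => le_max_right _ _) (by
        intro i
        have e3 : -∑ j, P i j * π j ≤ ∑ j, P i j * max (-π j) 0 := by
          rw [← Finset.sum_neg_distrib]
          refine Finset.sum_le_sum fun j _ => ?_
          rw [← mul_neg]
          exact mul_le_mul_of_nonneg_left (le_max_left _ _) (hP i j)
        have e4 : 0 ≤ ∑ j, P i j * max (-π j) 0 :=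
          Finset.sum_nonneg fun j _ => mul_nonneg (hP i j) (le_max_right _ _)
        refine max_le ?_ (mul_nonneg h0 e4)
        have e5 := mul_le_mul_of_nonneg_left e3 h0
        have e6 := mul_nonneg (sub_nonneg.2 h1.le) (hv.1 i)
        have := h2 i
        linarith)
    refine ⟨⟨fun i => ?_, hsum⟩, (stat π hsum).2 h2⟩
    have e7 := congrFun hneg i
    have e8 := le_max_left (-π i) 0
    simp only [Pi.zero_apply] at e7
    linarith

end PageRankSBM

end

namespace PageRankSBM

theorem transition_apply {n : ℕ} (A : Matrix (Fin n) (Fin n) ℝ) (i j : Fin n) :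
    transition A i j = A i j * (degree A j)⁻¹ := by
  simp [transition, Matrix.mul_diagonal]

theorem transition_nonneg {n : ℕ} {A : Matrix (Fin n) (Fin n) ℝ} (hA : ∀ i j, 0 ≤ A i j)
    (i j : Fin n) : 0 ≤ transition A i j := by
  rw [transition_apply]
  exact mul_nonneg (hA i j) (inv_nonneg.2 (Finset.sum_nonneg fun k _ => hA j k))

theorem sum_col_eq_degree {n : ℕ} {A : Matrix (Fin n) (Fin n) ℝ} (hs : A.IsSymm) (j : Fin n) :
    ∑ i, A i j = degree A j :=
  Finset.sum_congr rfl fun i _ => hs.apply j i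

theorem sum_transition {n : ℕ} {A : Matrix (Fin n) (Fin n) ℝ} (hs : A.IsSymm)
    (hd : ∀ i, 0 < degree A i) (j : Fin n) : ∑ i, transition A i j = 1 := by
  simp only [transition_apply]
  rw [← Finset.sum_mul, sum_col_eq_degree hs, mul_inv_cancel₀ (hd j).ne']

/-- PageRank is a probability vector and satisfies its fixed point equation. -/
theorem pageRank_spec {n : ℕ} {α : ℝ} (h0 : 0 ≤ α) (h1 : α < 1)
    {A : Matrix (Fin n) (Fin n) ℝ} (hA : ∀ i j, 0 ≤ A i j) (hs : A.IsSymm)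
    (hd : ∀ i, 0 < degree A i) {v : Fin n → ℝ} (hv : IsProbVec v) :
    IsProbVec (pageRank α (transition A) v) ∧
      ∀ i, pageRank α (transition A) v i =
        α * ∑ j, transition A i j * pageRank α (transition A) v j + (1 - α) * v i := by
  obtain ⟨h, h2⟩ := (isPageRank_iff h0 h1 (transition_nonneg hA) (sum_transition hs hd) hv _).2 rfl
  refine ⟨h, fun i => ?_⟩
  have h3 := congrFun h2 i
  simp only [Matrix.add_mulVec, Matrix.smul_mulVec, Pi.add_apply, Pi.smul_apply, smul_eq_mul] at h3
  simp only [Matrix.mulVec, dotProduct, Matrix.vecMulVec_apply, Pi.one_apply, mul_one,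
    ← Finset.mul_sum, h.2] at h3
  exact h3.symm

/-- Stability of the fixed point equation of PageRank in the `ℓ¹` norm. -/
theorem sum_abs_sub_le {n : ℕ} {α : ℝ} (h0 : 0 ≤ α)
    {P Q : Matrix (Fin n) (Fin n) ℝ} (hP : ∀ i j, 0 ≤ P i j) (hs : ∀ j, ∑ i, P i j = 1)
    {v x y : Fin n → ℝ} (hx : ∀ i, x i = α * ∑ j, P i j * x j + (1 - α) * v i)
    (hy : ∀ i, y i = α * ∑ j, Q i j * y j + (1 - α) * v i) :
    (1 - α) * ∑ i, |x i - y i| ≤ α * ∑ i, |∑ j, (P i j - Q i j) * y j| := by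
  have key : ∀ i, |x i - y i| ≤
      α * ∑ j, P i j * |x j - y j| + α * |∑ j, (P i j - Q i j) * y j| := by
    intro i
    have e : x i - y i = α * ∑ j, P i j * (x j - y j) + α * ∑ j, (P i j - Q i j) * y j := by
      rw [hx i, hy i, ← mul_add, ← Finset.sum_add_distrib, add_sub_add_right_eq_sub, ← mul_sub,
        ← Finset.sum_sub_distrib]
      congr 1
      exact Finset.sum_congr rfl fun j _ => by ring
    rw [e]
    refine (abs_add_le _ _).trans ?_
    rw [abs_mul, abs_mul, abs_of_nonneg h0]
    gcongr
    refine (Finset.abs_sum_le_sum_abs _ _).trans (Finset.sum_le_sum fun j _ => ?_)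
    rw [abs_mul, abs_of_nonneg (hP i j)]
  have h2 := Finset.sum_le_sum fun i (_ : i ∈ Finset.univ) => key i
  rw [Finset.sum_add_distrib, ← Finset.mul_sum, ← Finset.mul_sum, Finset.sum_comm] at h2
  simp only [← Finset.sum_mul, hs, one_mul] at h2
  linarith

/-- Comparison of the PageRanks of two weighted graphs whose degrees are close. -/
theorem tvDist_pageRank_le {n : ℕ} {α ε : ℝ} (h0 : 0 ≤ α) (h1 : α < 1)
    {A M : Matrix (Fin n) (Fin n) ℝ} (hA : ∀ i j, 0 ≤ A i j) (hsA : A.IsSymm)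
    (hdA : ∀ i, 0 < degree A i) (hM : ∀ i j, 0 ≤ M i j) (hsM : M.IsSymm)
    (hdM : ∀ i, 0 < degree M i) {v : Fin n → ℝ} (hv : IsProbVec v)
    (hε : ∀ i, |degree A i - degree M i| ≤ ε * degree M i) :
    tvDist (pageRank α (transition A) v) (pageRank α (transition M) v) ≤
      (∑ i, |∑ j, (A i j - M i j) * (pageRank α (transition M) v j / degree M j)| + ε) /
        (1 - α) := by
  obtain ⟨-, hx⟩ := pageRank_spec h0 h1 hA hsA hdA hv
  obtain ⟨hy, hy'⟩ := pageRank_spec h0 h1 hM hsM hdM hv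
  have h2 := sum_abs_sub_le h0 (transition_nonneg hA) (sum_transition hsA hdA) hx hy'
  set y := pageRank α (transition M) v
  have h3 : ∑ i, |∑ j, (transition A i j - transition M i j) * y j| ≤
      ∑ i, |∑ j, (A i j - M i j) * (y j / degree M j)| + ε := by
    have e : ∀ i, ∑ j, (transition A i j - transition M i j) * y j =
        ∑ j, (A i j - M i j) * (y j / degree M j) +
          ∑ j, A i j * ((degree A j)⁻¹ - (degree M j)⁻¹) * y j := by
      intro i
      rw [← Finset.sum_add_distrib]
      refine Finset.sum_congr rfl fun j _ => ?_
      rw [transition_apply, transition_apply]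
      ring
    have h4 : ∑ i, |∑ j, A i j * ((degree A j)⁻¹ - (degree M j)⁻¹) * y j| ≤ ε := by
      calc ∑ i, |∑ j, A i j * ((degree A j)⁻¹ - (degree M j)⁻¹) * y j|
          ≤ ∑ i, ∑ j, A i j * (|(degree A j)⁻¹ - (degree M j)⁻¹| * y j) := by
            refine Finset.sum_le_sum fun i _ => (Finset.abs_sum_le_sum_abs _ _).trans
              (Finset.sum_le_sum fun j _ => ?_)
            rw [abs_mul, abs_mul, abs_of_nonneg (hA i j), abs_of_nonneg (hy.1 j), mul_assoc]
        _ = ∑ j, degree A j * (|(degree A j)⁻¹ - (degree M j)⁻¹| * y j) := by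
            rw [Finset.sum_comm]
            simp only [← Finset.sum_mul, sum_col_eq_degree hsA]
        _ ≤ ∑ j, ε * y j := by
            refine Finset.sum_le_sum fun j _ => ?_
            rw [← mul_assoc]
            refine mul_le_mul_of_nonneg_right ?_ (hy.1 j)
            have h5 : degree A j * |(degree A j)⁻¹ - (degree M j)⁻¹| =
                |degree A j - degree M j| / degree M j := by
              have ha := hdA j
              have hm := hdM j
              have h6 : (degree A j)⁻¹ - (degree M j)⁻¹ =
                  -(degree A j - degree M j) / (degree A j * degree M j) := by
                field_simp
                ring
              rw [h6, abs_div, abs_neg, abs_of_pos (mul_pos ha hm)]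
              field_simp
            rw [h5, div_le_iff₀ (hdM j)]
            exact hε j
        _ = ε := by rw [← Finset.mul_sum, hy.2, mul_one]
    calc _ ≤ ∑ i, (|∑ j, (A i j - M i j) * (y j / degree M j)| +
          |∑ j, A i j * ((degree A j)⁻¹ - (degree M j)⁻¹) * y j|) :=
          Finset.sum_le_sum fun i _ => by rw [e i]; exact abs_add_le _ _
      _ ≤ _ := by rw [Finset.sum_add_distrib]; linarith
  have h7 : 0 ≤ ∑ i, |∑ j, (transition A i j - transition M i j) * y j| :=
    Finset.sum_nonneg fun i _ => abs_nonneg _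
  rw [le_div_iff₀ (by linarith), tvDist]
  nlinarith

/-- PageRank does not increase the `ℓ²` norm with weights the inverse degrees. -/
theorem sum_sq_pageRank_div_le {n : ℕ} {α : ℝ} (h0 : 0 ≤ α) (h1 : α < 1)
    {M : Matrix (Fin n) (Fin n) ℝ} (hM : ∀ i j, 0 ≤ M i j) (hs : M.IsSymm)
    (hd : ∀ i, 0 < degree M i) {v : Fin n → ℝ} (hv : IsProbVec v) :
    ∑ i, pageRank α (transition M) v i ^ 2 / degree M i ≤ ∑ i, v i ^ 2 / degree M i := by
  obtain ⟨-, hx⟩ := pageRank_spec h0 h1 hM hs hd hv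
  set x := pageRank α (transition M) v
  have cs : ∀ i, (∑ j, transition M i j * x j) ^ 2 ≤
      degree M i * ∑ j, M i j * (x j / degree M j) ^ 2 := by
    intro i
    have := Finset.sum_sq_le_sum_mul_sum_of_sq_le_mul Finset.univ
      (r := fun j => transition M i j * x j) (f := fun j => M i j)
      (g := fun j => M i j * (x j / degree M j) ^ 2) (fun j _ => hM i j)
      (fun j _ => mul_nonneg (hM i j) (sq_nonneg _)) (fun j _ => by
        rw [transition_apply]; exact (by ring : _ = _).le)
    exact this
  have pt : ∀ i, x i ^ 2 / degree M i ≤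
      α * ∑ j, M i j * (x j / degree M j) ^ 2 + (1 - α) * (v i ^ 2 / degree M i) := by
    intro i
    rw [div_le_iff₀ (hd i)]
    have e : (α * ∑ j, M i j * (x j / degree M j) ^ 2 + (1 - α) * (v i ^ 2 / degree M i)) *
        degree M i = α * (degree M i * ∑ j, M i j * (x j / degree M j) ^ 2) +
          (1 - α) * v i ^ 2 := by
      have := (hd i).ne'
      field_simp
    rw [e, hx i]
    have h2 := mul_le_mul_of_nonneg_left (cs i) h0
    set s := ∑ j, transition M i j * x j
    nlinarith [mul_nonneg (mul_nonneg h0 (sub_nonneg.2 h1.le)) (sq_nonneg (s - v i))]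
  have h3 := Finset.sum_le_sum fun i (_ : i ∈ Finset.univ) => pt i
  rw [Finset.sum_add_distrib, ← Finset.mul_sum, ← Finset.mul_sum, Finset.sum_comm] at h3
  have h4 : ∑ j, ∑ i, M i j * (x j / degree M j) ^ 2 = ∑ j, x j ^ 2 / degree M j := by
    refine Finset.sum_congr rfl fun j _ => ?_
    rw [← Finset.sum_mul, sum_col_eq_degree hs]
    have := (hd j).ne'
    field_simp
  rw [h4] at h3
  nlinarith

end PageRankSBM

section BoundedDifferences

variable {Ω : Type*} [Finite Ω] [MeasurableSpace Ω] [MeasurableSingletonClass Ω]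

/-- Exponential moments of a function with bounded differences on a product indexed by `Fin m`. -/
theorem integral_exp_le_of_bounded_differences_fin {m : ℕ} (μ : Fin m → Measure Ω)
    [∀ i, IsProbabilityMeasure (μ i)] (f : (Fin m → Ω) → ℝ) (c : Fin m → ℝ)
    (hf : ∀ i ω ω', (∀ j, j ≠ i → ω j = ω' j) → |f ω - f ω'| ≤ c i) (t : ℝ) :
    ∫ ω, Real.exp (t * f ω) ∂(Measure.pi μ) ≤
      Real.exp (t * ∫ ω, f ω ∂(Measure.pi μ) + (∑ i, c i ^ 2) * t ^ 2 / 2) := by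
  induction m with
  | zero =>
    have e : ∀ g : (Fin 0 → Ω) → ℝ, ∫ ω, g ω ∂(Measure.pi μ) = g default := by
      intro g
      rw [integral_unique]
      simp
    simp [e]
  | succ m ih =>
    set ν := Measure.pi fun j => μ (Fin.succAbove 0 j)
    have hmp := (measurePreserving_piFinSuccAbove μ 0).symm
    have split : ∀ g : (Fin (m + 1) → Ω) → ℝ, ∫ ω, g ω ∂(Measure.pi μ) =
        ∫ ω, ∫ a, g (Fin.cons a ω) ∂(μ 0) ∂ν := by
      intro g
      have hcons : ∀ a ω, (MeasurableEquiv.piFinSuccAbove (fun _ : Fin (m + 1) => Ω) 0).symm (a, ω) =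
          Fin.cons a ω := fun a ω => Fin.insertNth_zero' a ω
      rw [← hmp.integral_comp', integral_prod_symm _ .of_finite]
      simp only [hcons, ν]
    set g : (Fin m → Ω) → ℝ := fun ω => ∫ a, f (Fin.cons a ω) ∂(μ 0)
    have hoeffding : ∀ ω : Fin m → Ω, ∫ a, Real.exp (t * f (Fin.cons a ω)) ∂(μ 0) ≤
        Real.exp (c 0 ^ 2 * t ^ 2 / 2) * Real.exp (t * g ω) := by
      intro ω
      obtain ⟨a₀⟩ : Nonempty Ω := (μ 0).nonempty_of_neZero
      have hc : 0 ≤ c 0 := (abs_nonneg _).trans (hf 0 (Fin.cons a₀ ω) (Fin.cons a₀ ω) (by simp))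
      have h := (hasSubgaussianMGF_of_mem_Icc (μ := μ 0) (X := fun a => f (Fin.cons a ω))
        (a := f (Fin.cons a₀ ω) - c 0) (b := f (Fin.cons a₀ ω) + c 0)
        (measurable_of_countable _).aemeasurable (by
          refine Eventually.of_forall fun a => ?_
          have := abs_le.1 (hf 0 (Fin.cons a ω) (Fin.cons a₀ ω) (by
            intro j hj
            obtain ⟨k, rfl⟩ := Fin.exists_succ_eq.2 hj
            simp))
          constructor <;> linarith [this.1, this.2])).mgf_le t
      have e1 : f (Fin.cons a₀ ω) + c 0 - (f (Fin.cons a₀ ω) - c 0) = 2 * c 0 := by ring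
      rw [e1] at h
      have e2 : (((‖2 * c 0‖₊ / 2) ^ 2 : NNReal) : ℝ) = c 0 ^ 2 := by
        push_cast
        rw [Real.norm_eq_abs, abs_of_nonneg (by linarith)]
        ring
      rw [e2] at h
      have e3 : mgf (fun a => f (Fin.cons a ω) - g ω) (μ 0) t =
          (∫ a, Real.exp (t * f (Fin.cons a ω)) ∂(μ 0)) * Real.exp (-(t * g ω)) := by
        rw [mgf, ← integral_mul_const]
        congr 1
        ext a
        rw [← Real.exp_add]
        ring_nf
      rw [e3, Real.exp_neg, ← div_eq_mul_inv, div_le_iff₀ (Real.exp_pos _)] at h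
      exact h
    have hg : ∀ i ω ω', (∀ j, j ≠ i → ω j = ω' j) → |g ω - g ω'| ≤ c i.succ := by
      intro i ω ω' h
      rw [← integral_sub .of_finite .of_finite]
      have := norm_integral_le_of_norm_le_const (μ := μ 0)
        (f := fun a => f (Fin.cons a ω) - f (Fin.cons a ω')) (C := c i.succ)
        (Eventually.of_forall fun a => hf i.succ _ _ (by
          intro j hj
          induction j using Fin.cases with
          | zero => simp
          | succ k => simpa using h k (by rintro rfl; exact hj rfl)))
      simpa using this
    have step := ih (fun j => μ (Fin.succAbove 0 j)) g (fun i => c i.succ) hg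
    rw [split, split]
    calc ∫ ω, ∫ a, Real.exp (t * f (Fin.cons a ω)) ∂(μ 0) ∂ν
        ≤ ∫ ω, Real.exp (c 0 ^ 2 * t ^ 2 / 2) * Real.exp (t * g ω) ∂ν :=
          integral_mono .of_finite .of_finite hoeffding
      _ ≤ Real.exp (c 0 ^ 2 * t ^ 2 / 2) *
          Real.exp (t * ∫ ω, g ω ∂ν + (∑ i : Fin m, c i.succ ^ 2) * t ^ 2 / 2) := by
          rw [integral_const_mul]
          exact mul_le_mul_of_nonneg_left step (Real.exp_pos _).le
      _ = _ := by
          rw [← Real.exp_add, Fin.sum_univ_succ]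
          congr 1
          simp only [g]
          ring

/-- Exponential moments of a function with bounded differences on a finite product. -/
theorem integral_exp_le_of_bounded_differences {ι : Type*} [Fintype ι] (μ : ι → Measure Ω)
    [∀ i, IsProbabilityMeasure (μ i)] (f : (ι → Ω) → ℝ) (c : ι → ℝ)
    (hf : ∀ i ω ω', (∀ j, j ≠ i → ω j = ω' j) → |f ω - f ω'| ≤ c i) (t : ℝ) :
    ∫ ω, Real.exp (t * f ω) ∂(Measure.pi μ) ≤
      Real.exp (t * ∫ ω, f ω ∂(Measure.pi μ) + (∑ i, c i ^ 2) * t ^ 2 / 2) := by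
  let e := (Fintype.equivFin ι).symm
  have hmp := measurePreserving_piCongrLeft μ e
  have happ : ∀ (ω : Fin (Fintype.card ι) → Ω) i,
      MeasurableEquiv.piCongrLeft (fun _ => Ω) e ω i = ω (e.symm i) := by
    intro ω i
    obtain ⟨k, rfl⟩ := e.surjective i
    rw [MeasurableEquiv.coe_piCongrLeft, Equiv.piCongrLeft_apply_apply, e.symm_apply_apply]
  have h := integral_exp_le_of_bounded_differences_fin (fun k => μ (e k))
    (fun ω => f (MeasurableEquiv.piCongrLeft (fun _ => Ω) e ω)) (fun k => c (e k)) (by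
      intro k ω ω' hω
      refine hf (e k) _ _ fun j hj => ?_
      rw [happ, happ]
      exact hω _ fun h => hj (by rw [← h, e.apply_symm_apply])) t
  rw [hmp.integral_comp' (fun ω => Real.exp (t * f ω)), hmp.integral_comp' f,
    e.sum_comp (fun i => c i ^ 2)] at h
  exact h

/-- **McDiarmid's inequality** on a finite product space. -/
theorem measureReal_ge_le_of_bounded_differences {ι : Type*} [Fintype ι] (μ : ι → Measure Ω)
    [∀ i, IsProbabilityMeasure (μ i)] (f : (ι → Ω) → ℝ) (c : ι → ℝ)
    (hf : ∀ i ω ω', (∀ j, j ≠ i → ω j = ω' j) → |f ω - f ω'| ≤ c i) {V s : ℝ} (hV : 0 < V)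
    (hc : ∑ i, c i ^ 2 ≤ V) (hs : 0 ≤ s) :
    (Measure.pi μ).real {ω | ∫ ω, f ω ∂(Measure.pi μ) + s ≤ f ω} ≤
      Real.exp (-(s ^ 2 / (2 * V))) := by
  set E := ∫ ω, f ω ∂(Measure.pi μ)
  have h1 := measure_ge_le_exp_mul_mgf (μ := Measure.pi μ) (X := f) (t := s / V) (E + s)
    (div_nonneg hs hV.le) .of_finite
  refine h1.trans ?_
  have h2 := integral_exp_le_of_bounded_differences μ f c hf (s / V)
  calc Real.exp (-(s / V) * (E + s)) * mgf f (Measure.pi μ) (s / V)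
      ≤ Real.exp (-(s / V) * (E + s)) * Real.exp (s / V * E + V * (s / V) ^ 2 / 2) := by
        refine mul_le_mul_of_nonneg_left (h2.trans (Real.exp_le_exp.2 ?_)) (Real.exp_pos _).le
        gcongr
    _ = _ := by
        rw [← Real.exp_add]
        congr 1
        field_simp
        ring

end BoundedDifferences

namespace PageRankSBM

variable {n : ℕ} (loops : Bool) (C : Finset (Fin n)) (p q : unitInterval)

instance isProbabilityMeasure_sbm : IsProbabilityMeasure (sbm loops C p q) := by
  unfold sbm
  infer_instance

theorem integral_comp_eval_sbm (e : Sym2 (Fin n)) (g : Bool → ℝ) :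
    ∫ ω, g (ω e) ∂(sbm loops C p q) =
      edgeProb loops C p q e * g true + (1 - edgeProb loops C p q e) * g false := by
  have h : Measure.map (fun ω => ω e) (sbm loops C p q) =
      bernoulliMeasure true false (edgeProb loops C p q e) :=
    (measurePreserving_eval
      (fun e => bernoulliMeasure true false (edgeProb loops C p q e)) e).map_eq
  have h2 := integral_map (μ := sbm loops C p q) (φ := fun ω => ω e) (f := g)
    (measurable_pi_apply e).aemeasurable (measurable_of_countable g).aestronglyMeasurable
  rw [← h2, h, integral_bernoulliMeasure]
  simp

theorem adj_apply (ω : Sample n) (i j : Fin n) :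
    adj ω i j = if ω s(i, j) = true then 1 else 0 := rfl

theorem adj_nonneg (ω : Sample n) (i j : Fin n) : 0 ≤ adj ω i j := by
  rw [adj_apply]
  split_ifs <;> norm_num

theorem adj_isSymm (ω : Sample n) : (adj ω).IsSymm := by
  ext i j
  rw [Matrix.transpose_apply, adj_apply, adj_apply, Sym2.eq_swap]

theorem meanAdj_apply (i j : Fin n) :
    meanAdj loops C p q i j = edgeProb loops C p q s(i, j) := by
  have h := integral_comp_eval_sbm loops C p q s(i, j) (fun b => if b = true then 1 else 0)
  simp only [if_true, mul_one, Bool.false_eq_true, if_false, mul_zero, add_zero] at h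
  exact h

theorem meanAdj_nonneg (i j : Fin n) : 0 ≤ meanAdj loops C p q i j := by
  rw [meanAdj_apply]
  exact (edgeProb loops C p q s(i, j)).2.1

theorem meanAdj_isSymm : (meanAdj loops C p q).IsSymm := by
  ext i j
  rw [Matrix.transpose_apply, meanAdj_apply, meanAdj_apply, Sym2.eq_swap]

theorem meanDegree_eq (i : Fin n) :
    meanDegree loops C p q i = degree (meanAdj loops C p q) i :=
  integral_finsetSum _ fun _ _ => .of_finite

theorem meanTransition_eq :
    meanTransition loops C p q = transition (meanAdj loops C p q) := by
  unfold meanTransition transition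
  congr 2
  ext j
  rw [meanDegree_eq]

/-- The entries of a row of the adjacency matrix are independent. -/
theorem iIndepFun_adj_row (i : Fin n) (g : Fin n → ℝ → ℝ) :
    iIndepFun (fun j ω => g j (adj ω i j)) (sbm loops C p q) := by
  have h : iIndepFun (fun (e : Sym2 (Fin n)) (ω : Sample n) => ω e) (sbm loops C p q) :=
    iIndepFun_pi (X := fun _ => id) fun _ => aemeasurable_id
  have h2 := h.precomp (g := fun j => s(i, j)) fun j k hjk => Sym2.congr_right.1 hjk
  exact h2.comp (fun j b => g j (if b = true then 1 else 0)) fun j => measurable_of_countable _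

/-! ### Concentration of the degrees -/

theorem mgf_degree_le (i : Fin n) (t : ℝ) (ht : |t| ≤ 1) :
    mgf (fun ω => degree (adj ω) i) (sbm loops C p q) t ≤
      Real.exp (meanDegree loops C p q i * (t + t ^ 2)) := by
  have h := (iIndepFun_adj_row loops C p q i (fun _ x => x)).mgf_sum (t := t)
    (fun j => measurable_of_countable _) Finset.univ
  have e : (∑ j, fun ω : Sample n => adj ω i j) = fun ω => degree (adj ω) i := by
    ext ω
    simp [degree]
  rw [e] at h
  rw [h, meanDegree_eq, degree, Finset.sum_mul, Real.exp_sum]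
  refine Finset.prod_le_prod (fun j _ => mgf_nonneg) fun j _ => ?_
  have h2 := integral_comp_eval_sbm loops C p q s(i, j)
    (fun b => Real.exp (t * if b = true then 1 else 0))
  have h3 : mgf (fun ω => adj ω i j) (sbm loops C p q) t =
      meanAdj loops C p q i j * Real.exp t + (1 - meanAdj loops C p q i j) := by
    rw [meanAdj_apply]
    simp only [if_true, mul_one, Bool.false_eq_true, if_false, mul_zero, Real.exp_zero] at h2
    exact h2
  rw [h3]
  have h4 := (abs_le.1 (Real.abs_exp_sub_one_sub_id_le ht)).2
  have h5 := mul_le_mul_of_nonneg_left h4 (meanAdj_nonneg loops C p q i j)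
  have h6 := Real.add_one_le_exp (meanAdj loops C p q i j * (t + t ^ 2))
  linarith

/-- **Chernoff's inequality** for the degree of a vertex. -/
theorem measureReal_degree_le (i : Fin n) {ε : ℝ} (h0 : 0 ≤ ε) (h1 : ε ≤ 1) :
    (sbm loops C p q).real {ω | ε * meanDegree loops C p q i ≤
        |degree (adj ω) i - meanDegree loops C p q i|} ≤
      2 * Real.exp (-(ε ^ 2 * meanDegree loops C p q i / 4)) := by
  set d := meanDegree loops C p q i
  have hup := measure_ge_le_exp_mul_mgf (μ := sbm loops C p q) (X := fun ω => degree (adj ω) i)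
    (t := ε / 2) (d + ε * d) (by linarith) .of_finite
  have hlo := measure_le_le_exp_mul_mgf (μ := sbm loops C p q) (X := fun ω => degree (adj ω) i)
    (t := -(ε / 2)) (d - ε * d) (by linarith) .of_finite
  have b1 := mgf_degree_le loops C p q i (ε / 2) (abs_le.2 ⟨by linarith, by linarith⟩)
  have b2 := mgf_degree_le loops C p q i (-(ε / 2)) (abs_le.2 ⟨by linarith, by linarith⟩)
  have c1 := hup.trans (mul_le_mul_of_nonneg_left b1 (Real.exp_pos _).le)
  have c2 := hlo.trans (mul_le_mul_of_nonneg_left b2 (Real.exp_pos _).le)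
  rw [← Real.exp_add] at c1 c2
  have e1 : -(ε / 2) * (d + ε * d) + d * (ε / 2 + (ε / 2) ^ 2) = -(ε ^ 2 * d / 4) := by ring
  have e2 : -(-(ε / 2)) * (d - ε * d) + d * (-(ε / 2) + (-(ε / 2)) ^ 2) =
      -(ε ^ 2 * d / 4) := by ring
  rw [e1] at c1
  rw [e2] at c2
  have hsub : {ω : Sample n | ε * d ≤ |degree (adj ω) i - d|} ⊆
      {ω | d + ε * d ≤ degree (adj ω) i} ∪ {ω | degree (adj ω) i ≤ d - ε * d} := by
    intro ω hω
    have hω' : ε * d ≤ |degree (adj ω) i - d| := hω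
    rcases le_abs.1 hω' with h | h
    · left
      change d + ε * d ≤ degree (adj ω) i
      linarith
    · right
      change degree (adj ω) i ≤ d - ε * d
      linarith
  calc _ ≤ _ := measureReal_mono hsub
    _ ≤ _ := measureReal_union_le _ _
    _ ≤ _ := by linarith

/-! ### Concentration of the centred adjacency matrix on a fixed vector -/

/-- The `ℓ¹` norm of `(A - 𝔼 A) y`. -/
noncomputable def deviation (y : Fin n → ℝ) (ω : Sample n) : ℝ :=
  ∑ i, |∑ j, (adj ω i j - meanAdj loops C p q i j) * y j|

theorem integral_sq_row_le (y : Fin n → ℝ) (i : Fin n) :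
    ∫ ω, (∑ j, (adj ω i j - meanAdj loops C p q i j) * y j) ^ 2 ∂(sbm loops C p q) ≤
      ∑ j, meanAdj loops C p q i j * y j ^ 2 := by
  have hind := iIndepFun_adj_row loops C p q i (fun j x => x * y j)
  have hvar := IndepFun.variance_sum (μ := sbm loops C p q) (s := Finset.univ)
    (X := fun j (ω : Sample n) => adj ω i j * y j) (fun j _ => .of_discrete)
    (fun j _ k _ hjk => hind.indepFun hjk)
  have hmean : ∫ ω, (∑ j, fun ω : Sample n => adj ω i j * y j) ω ∂(sbm loops C p q) =
      ∑ j, meanAdj loops C p q i j * y j := by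
    simp only [Finset.sum_apply]
    rw [integral_finsetSum _ fun _ _ => .of_finite]
    refine Finset.sum_congr rfl fun j _ => ?_
    rw [integral_mul_const]
    rfl
  rw [variance_eq_integral (measurable_of_countable _).aemeasurable, hmean] at hvar
  have e : ∀ ω : Sample n, ∑ j, (adj ω i j - meanAdj loops C p q i j) * y j =
      (∑ j, fun ω : Sample n => adj ω i j * y j) ω - ∑ j, meanAdj loops C p q i j * y j := by
    intro ω
    rw [Finset.sum_apply, ← Finset.sum_sub_distrib]
    exact Finset.sum_congr rfl fun j _ => by ring
  simp only [e]
  rw [hvar]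
  refine Finset.sum_le_sum fun j _ => ?_
  refine (variance_le_expectation_sq (measurable_of_countable _).aestronglyMeasurable).trans
    (le_of_eq ?_)
  have h2 : ∀ ω : Sample n, ((fun ω : Sample n => adj ω i j * y j) ^ 2) ω =
      adj ω i j * y j ^ 2 := by
    intro ω
    simp only [Pi.pow_apply, adj_apply]
    split_ifs <;> simp
  simp only [h2]
  rw [integral_mul_const]
  rfl

theorem sq_integral_le (f : Sample n → ℝ) :
    (∫ ω, f ω ∂(sbm loops C p q)) ^ 2 ≤ ∫ ω, f ω ^ 2 ∂(sbm loops C p q) := by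
  have h := variance_nonneg f (sbm loops C p q)
  rw [variance_eq_sub .of_discrete] at h
  simpa using h

theorem sq_integral_deviation_le (y : Fin n → ℝ) :
    (∫ ω, deviation loops C p q y ω ∂(sbm loops C p q)) ^ 2 ≤
      n * ∑ j, meanDegree loops C p q j * y j ^ 2 := by
  unfold deviation
  rw [integral_finsetSum _ fun _ _ => .of_finite]
  refine (sq_sum_le_card_mul_sum_sq (s := Finset.univ)).trans ?_
  rw [Finset.card_univ, Fintype.card_fin]
  refine mul_le_mul_of_nonneg_left ?_ n.cast_nonneg
  calc _ ≤ ∑ i, ∑ j, meanAdj loops C p q i j * y j ^ 2 := by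
        refine Finset.sum_le_sum fun i _ => (sq_integral_le _ _ _ _ _).trans ?_
        simp only [sq_abs]
        exact integral_sq_row_le loops C p q y i
    _ = _ := by
        rw [Finset.sum_comm]
        refine Finset.sum_congr rfl fun j _ => ?_
        rw [← Finset.sum_mul, sum_col_eq_degree (meanAdj_isSymm loops C p q), meanDegree_eq]

/-- The effect on `deviation` of changing the pair `e`. -/
noncomputable def influence (y : Fin n → ℝ) (e : Sym2 (Fin n)) : ℝ :=
  ∑ x : Fin n × Fin n with s(x.1, x.2) = e, |y x.2|

theorem abs_deviation_sub_le (y : Fin n → ℝ) (e : Sym2 (Fin n)) (ω ω' : Sample n)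
    (h : ∀ e', e' ≠ e → ω e' = ω' e') :
    |deviation loops C p q y ω - deviation loops C p q y ω'| ≤ influence y e := by
  unfold deviation influence
  rw [← Finset.sum_sub_distrib, Finset.sum_filter, Fintype.sum_prod_type]
  refine (Finset.abs_sum_le_sum_abs _ _).trans (Finset.sum_le_sum fun i _ => ?_)
  refine (abs_abs_sub_abs_le _ _).trans ?_
  rw [← Finset.sum_sub_distrib]
  refine (Finset.abs_sum_le_sum_abs _ _).trans (Finset.sum_le_sum fun j _ => ?_)
  rw [← sub_mul, sub_sub_sub_cancel_right, abs_mul, adj_apply, adj_apply]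
  split_ifs with h1 h2 h3 h4 <;> simp_all

theorem sum_sq_influence_le (y : Fin n → ℝ) :
    ∑ e, influence y e ^ 2 ≤ 2 * (n * ∑ j, y j ^ 2) := by
  have h : ∀ e, influence y e ^ 2 ≤
      2 * ∑ x : Fin n × Fin n with s(x.1, x.2) = e, y x.2 ^ 2 := by
    intro e
    refine (sq_sum_le_card_mul_sum_sq).trans ?_
    simp only [sq_abs]
    refine mul_le_mul_of_nonneg_right ?_ (Finset.sum_nonneg fun _ _ => sq_nonneg _)
    induction e with
    | _ a b =>
      have hsub : (Finset.univ.filter fun x : Fin n × Fin n => s(x.1, x.2) = s(a, b)) ⊆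
          {(a, b), (b, a)} := by
        rintro ⟨i, j⟩ hx
        simpa using hx
      exact_mod_cast (Finset.card_le_card hsub).trans Finset.card_le_two
  refine (Finset.sum_le_sum fun e _ => h e).trans (le_of_eq ?_)
  rw [← Finset.mul_sum, Finset.sum_fiberwise, Fintype.sum_prod_type]
  simp

theorem measureReal_deviation_ge_le (y : Fin n → ℝ) {V s : ℝ} (hV : 0 < V)
    (hy : 2 * (n * ∑ j, y j ^ 2) ≤ V) (hs : 0 ≤ s) :
    (sbm loops C p q).real {ω | ∫ ω, deviation loops C p q y ω ∂(sbm loops C p q) + s ≤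
        deviation loops C p q y ω} ≤ Real.exp (-(s ^ 2 / (2 * V))) :=
  measureReal_ge_le_of_bounded_differences
    (fun e => bernoulliMeasure true false (edgeProb loops C p q e)) _ (influence y)
    (abs_deviation_sub_le loops C p q y) hV ((sum_sq_influence_le y).trans hy) hs

end PageRankSBM

namespace PageRankSBM

/-- Nonasymptotic comparison of the PageRank of a sample of the stochastic block model with the
PageRank of the averaged graph. -/
theorem measureReal_tvDist_le {n : ℕ} (loops : Bool) (C : Finset (Fin n)) (p q : unitInterval)
    {α : ℝ} (h0 : 0 ≤ α) (h1 : α < 1) {v : Fin n → ℝ} (hv : IsProbVec v) {B w ε : ℝ}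
    (hB : 0 < B) (hvB : n * ∑ i, v i ^ 2 ≤ B ^ 2) (hw : 1 ≤ w)
    (hwd : ∀ i, w ≤ meanDegree loops C p q i) (hlog : 1 ≤ 8 * Real.log n)
    (hε0 : 0 ≤ ε) (hε : ε ^ 2 * w = 8 * Real.log n) (hε1 : ε < 1) :
    1 - 3 * (n : ℝ) ^ (-1 : ℝ) ≤ (sbm loops C p q).real
      {ω | (∀ i, 0 < degree (adj ω) i) ∧
        tvDist (pageRank α (transition (adj ω)) v)
          (pageRank α (meanTransition loops C p q) v) ≤ (2 * B + 1) / (1 - α) * ε} := by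
  set μ := sbm loops C p q
  set d := meanDegree loops C p q
  have hw0 : 0 < w := by linarith
  have hd0 : ∀ i, 0 < d i := fun i => hw0.trans_le (hwd i)
  have hdM : ∀ i, 0 < degree (meanAdj loops C p q) i := fun i => by
    rw [← meanDegree_eq]; exact hd0 i
  have hn : (0 : ℝ) < n := by
    rcases n.eq_zero_or_pos with rfl | h
    · norm_num at hlog
    · exact_mod_cast h
  set x := pageRank α (transition (meanAdj loops C p q)) v
  have hx : ∑ j, x j ^ 2 / d j ≤ (∑ j, v j ^ 2) / w := by
    have h := sum_sq_pageRank_div_le h0 h1 (meanAdj_nonneg loops C p q)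
      (meanAdj_isSymm loops C p q) hdM hv
    simp only [← meanDegree_eq] at h
    refine h.trans ?_
    rw [Finset.sum_div]
    exact Finset.sum_le_sum fun i _ => div_le_div_of_nonneg_left (sq_nonneg _) hw0 (hwd i)
  have hxB : n * ∑ j, x j ^ 2 / d j ≤ B ^ 2 / w := by
    calc n * ∑ j, x j ^ 2 / d j ≤ n * ((∑ j, v j ^ 2) / w) := by gcongr
      _ = (n * ∑ j, v j ^ 2) / w := by ring
      _ ≤ _ := by gcongr
  set y : Fin n → ℝ := fun j => x j / d j
  have hdy : ∑ j, d j * y j ^ 2 = ∑ j, x j ^ 2 / d j := by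
    refine Finset.sum_congr rfl fun j _ => ?_
    have := (hd0 j).ne'
    simp only [y]
    field_simp
  have hyw : ∑ j, y j ^ 2 ≤ (∑ j, x j ^ 2 / d j) / w := by
    rw [← hdy, le_div_iff₀ hw0, Finset.sum_mul]
    refine Finset.sum_le_sum fun j _ => ?_
    rw [mul_comm]
    exact mul_le_mul_of_nonneg_right (hwd j) (sq_nonneg _)
  have hV : 2 * (n * ∑ j, y j ^ 2) ≤ 2 * (B ^ 2 / w ^ 2) := by
    have : n * ∑ j, y j ^ 2 ≤ B ^ 2 / w ^ 2 := by
      calc n * ∑ j, y j ^ 2 ≤ n * ((∑ j, x j ^ 2 / d j) / w) := by gcongr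
        _ = (n * ∑ j, x j ^ 2 / d j) / w := by ring
        _ ≤ B ^ 2 / w / w := by gcongr
        _ = _ := by field_simp
    linarith
  have hmean : ∫ ω, deviation loops C p q y ω ∂μ ≤ B * ε := by
    refine abs_le_of_sq_le_sq' ?_ (mul_nonneg hB.le hε0) |>.2
    refine (sq_integral_deviation_le loops C p q y).trans ?_
    rw [hdy]
    refine hxB.trans ?_
    rw [div_le_iff₀ hw0, mul_pow, mul_assoc, hε]
    nlinarith [sq_nonneg B]
  have hexp : ∀ {a : ℝ}, Real.log n ≤ a → Real.exp (-a) ≤ (n : ℝ)⁻¹ := by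
    intro a ha
    calc Real.exp (-a) ≤ Real.exp (-Real.log n) := Real.exp_le_exp.2 (neg_le_neg ha)
      _ = (n : ℝ)⁻¹ := by rw [Real.exp_neg, Real.exp_log hn]
  have hdev : μ.real {ω | ∫ ω, deviation loops C p q y ω ∂μ + B * ε ≤
      deviation loops C p q y ω} ≤ (n : ℝ)⁻¹ := by
    refine (measureReal_deviation_ge_le loops C p q y (by positivity) hV
      (mul_nonneg hB.le hε0)).trans (hexp ?_)
    have e : (B * ε) ^ 2 / (2 * (2 * (B ^ 2 / w ^ 2))) = w * (ε ^ 2 * w) / 4 := by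
      field_simp
      ring
    rw [e, hε]
    nlinarith
  have hdeg : μ.real (⋃ i, {ω | ε * d i ≤ |degree (adj ω) i - d i|}) ≤ 2 * (n : ℝ)⁻¹ := by
    refine (measureReal_iUnion_fintype_le _).trans ?_
    calc ∑ i, μ.real {ω | ε * d i ≤ |degree (adj ω) i - d i|}
        ≤ ∑ _i : Fin n, 2 * ((n : ℝ)⁻¹ * (n : ℝ)⁻¹) := by
          refine Finset.sum_le_sum fun i _ =>
            (measureReal_degree_le loops C p q i hε0 hε1.le).trans ?_
          refine mul_le_mul_of_nonneg_left ?_ (by norm_num)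
          have h2 : 2 * Real.log n ≤ ε ^ 2 * d i / 4 := by
            have := mul_le_mul_of_nonneg_left (hwd i) (sq_nonneg ε)
            linarith
          calc Real.exp (-(ε ^ 2 * d i / 4)) ≤ Real.exp (-Real.log n + -Real.log n) :=
                Real.exp_le_exp.2 (by linarith)
            _ = _ := by rw [Real.exp_add, Real.exp_neg, Real.exp_log hn]
      _ = 2 * (n : ℝ)⁻¹ := by
          rw [Finset.sum_const, Finset.card_univ, Fintype.card_fin, nsmul_eq_mul]
          field_simp
  set bad := {ω | ∫ ω, deviation loops C p q y ω ∂μ + B * ε ≤ deviation loops C p q y ω} ∪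
    ⋃ i, {ω | ε * d i ≤ |degree (adj ω) i - d i|}
  have hbad : μ.real bad ≤ 3 * (n : ℝ)⁻¹ :=
    (measureReal_union_le _ _).trans (by linarith)
  have hcompl := probReal_compl_eq_one_sub (μ := μ) (s := bad) (Set.toFinite _).measurableSet
  rw [Real.rpow_neg_one]
  calc 1 - 3 * (n : ℝ)⁻¹ ≤ μ.real badᶜ := by rw [hcompl]; linarith
    _ ≤ _ := measureReal_mono fun ω hω => ?_
  have hω1 : deviation loops C p q y ω < ∫ ω, deviation loops C p q y ω ∂μ + B * ε :=
    not_le.1 fun h => hω (Or.inl h)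
  have hω2 : ∀ i, |degree (adj ω) i - d i| < ε * d i :=
    fun i => not_le.1 fun h => hω (Or.inr (Set.mem_iUnion.2 ⟨i, h⟩))
  have hpos : ∀ i, 0 < degree (adj ω) i := by
    intro i
    have h2 := (abs_lt.1 (hω2 i)).1
    nlinarith [hd0 i]
  refine ⟨hpos, ?_⟩
  rw [meanTransition_eq]
  refine (tvDist_pageRank_le h0 h1 (adj_nonneg ω) (adj_isSymm ω) hpos (meanAdj_nonneg loops C p q)
    (meanAdj_isSymm loops C p q) hdM hv (ε := ε) fun i => ?_).trans ?_
  · rw [← meanDegree_eq]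
    exact (hω2 i).le
  · simp only [← meanDegree_eq]
    rw [div_mul_eq_mul_div]
    refine div_le_div_of_nonneg_right ?_ (by linarith)
    have e : deviation loops C p q y ω =
      ∑ i, |∑ j, (adj ω i j - meanAdj loops C p q i j) * (x j / d j)| := rfl
    rw [← e]
    linarith

end PageRankSBM

open PageRankSBM in
theorem theorem3 (α : ℝ) (hα0 : 0 ≤ α) (hα1 : α < 1)
    (loops : Bool) (C : ∀ n : ℕ, Finset (Fin n)) (p q : ℕ → unitInterval)
    (v : ∀ n : ℕ, Fin n → ℝ)
    (hv : ∀ n : ℕ, 0 < n → IsProbVec (v n))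
    (hw : (fun n : ℕ => Real.log n ^ 3) =o[atTop] fun n => wMin loops (C n) (p n) (q n))
    (K : ℝ)
    (hK : ∀ᶠ n : ℕ in atTop, wMax loops (C n) (p n) (q n) / wMin loops (C n) (p n) (q n) ≤ K)
    (hv2 : (fun n : ℕ => norm2 (v n)) =O[atTop] fun n : ℕ => 1 / Real.sqrt n) :
    ∃ ψ : ℕ → ℝ, Tendsto ψ atTop (𝓝 0) ∧
      WHP (fun n => sbm loops (C n) (p n) (q n)) (fun n =>
        {ω | (∀ i, 0 < degree (adj ω) i) ∧
          tvDist (pageRank α (transition (adj ω)) (v n))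
            (pageRank α (meanTransition loops (C n) (p n) (q n)) (v n)) ≤ ψ n}) := by
  have hlogn : Tendsto (fun n : ℕ => Real.log n) atTop atTop :=
    Real.tendsto_log_atTop.comp tendsto_natCast_atTop_atTop
  set w : ℕ → ℝ := fun n => wMin loops (C n) (p n) (q n)
  have hle : ∀ᶠ n : ℕ in atTop, Real.log n ^ 3 ≤ w n := by
    filter_upwards [hw.bound one_pos, hlogn.eventually_ge_atTop 0] with n h1 h2
    have h3 : 0 ≤ w n := by
      refine Real.iInf_nonneg fun i => integral_nonneg fun ω => Finset.sum_nonneg fun j _ => ?_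
      exact adj_nonneg ω i j
    rwa [one_mul, Real.norm_eq_abs, Real.norm_eq_abs, abs_of_nonneg h3,
      abs_of_nonneg (pow_nonneg h2 3)] at h1
  obtain ⟨B, hB, hvB⟩ := hv2.exists_pos
  have hε : Tendsto (fun n : ℕ => Real.sqrt (8 * Real.log n / w n)) atTop (𝓝 0) := by
    have h1 : Tendsto (fun n : ℕ => 8 * Real.log n / w n) atTop (𝓝 0) := by
      have h2 : Tendsto (fun n : ℕ => 8 / Real.log n) atTop (𝓝 0) := hlogn.const_div_atTop 8
      refine tendsto_of_tendsto_of_tendsto_of_le_of_le' tendsto_const_nhds h2 ?_ ?_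
      · filter_upwards [hle, hlogn.eventually_ge_atTop 1] with n h3 h4
        have h5 : 0 ≤ w n := (pow_nonneg (by linarith) 3).trans h3
        positivity
      · filter_upwards [hle, hlogn.eventually_ge_atTop 1] with n h3 h4
        have h5 : 0 < Real.log n := by linarith
        rw [div_le_div_iff₀ ((pow_pos h5 3).trans_le h3) h5]
        nlinarith [pow_pos h5 2]
    simpa using h1.sqrt
  refine ⟨fun n => (2 * B + 1) / (1 - α) * Real.sqrt (8 * Real.log n / w n), ?_, ?_⟩
  · simpa using hε.const_mul ((2 * B + 1) / (1 - α))
  · have hev : ∀ᶠ n : ℕ in atTop, 1 - 3 * (n : ℝ) ^ (-1 : ℝ) ≤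
        (sbm loops (C n) (p n) (q n)).real {ω | (∀ i, 0 < degree (adj ω) i) ∧
          tvDist (pageRank α (transition (adj ω)) (v n))
            (pageRank α (meanTransition loops (C n) (p n) (q n)) (v n)) ≤
              (2 * B + 1) / (1 - α) * Real.sqrt (8 * Real.log n / w n)} := by
      filter_upwards [hle, hlogn.eventually_ge_atTop 1, hvB.bound,
        hε.eventually_lt_const one_pos, eventually_gt_atTop 0] with n h1 h2 h3 h4 h5
      have hw1 : 1 ≤ w n := (one_le_pow₀ h2).trans h1
      have hn : (0 : ℝ) < n := by exact_mod_cast h5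
      refine measureReal_tvDist_le loops (C n) (p n) (q n) hα0 hα1 (hv n h5) hB ?_ hw1
        (fun i => ciInf_le (Set.finite_range _).bddBelow i) (by linarith) (Real.sqrt_nonneg _)
        ?_ h4
      · rw [norm2, Real.norm_eq_abs, Real.norm_eq_abs, abs_of_nonneg (Real.sqrt_nonneg _),
          abs_of_nonneg (by positivity), mul_one_div, le_div_iff₀ (Real.sqrt_pos.2 hn)] at h3
        have h6 := pow_le_pow_left₀ (by positivity) h3 2
        rwa [mul_pow, Real.sq_sqrt (Finset.sum_nonneg fun _ _ => sq_nonneg _),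
          Real.sq_sqrt hn.le, mul_comm] at h6
      · rw [Real.sq_sqrt (by positivity)]
        field_simp
    obtain ⟨N, hN⟩ := eventually_atTop.1 hev
    exact ⟨1, one_pos, 3, N, fun n hn => hN n hn.le⟩
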